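/- Let $H\subseteq\mathbb N$ be a proportionally modular numerical semigroup of embedding dimension $3$; that is, $H$ has finite complement in $\mathbb N$, it is minimally generated by three elements, and $H=\{x\in\mathbb N : (px \bmod q)\le rx\}$ for some positive integers $p,q,r$. Name the minimal generators $a,b,c$, $H=\langle a,b,c\rangle$, in an order for which $db=a+c$ for some integer $d$ (such an order exists, and then $d\ge 2$ and $\gcd(a,b)=\gcd(b,c)=1$). Let $F(H)$ be the largest integer not in $H$; $H$ is called pseudo-symmetric if $F(H)$ is even and for every $z\in\mathbb Z$ with $z\ne F(H)/2$ one has $z\in H$ or $F(H)-z\in H$ (equivalently, $2\,|\mathbb N\setminus H|=F(H)+2$). Let $k$ be a field. A defining matrix of $H$ is a matrix $$\begin{pmatrix} X^{\alpha} & Y^{\beta} & Z^{\gamma}\\ Y^{\beta'} & Z^{\gamma'} & X^{\alpha'}\end{pmatrix}$$ with positive integer exponents whose $2\times 2$ minors generate the kernel of the $k$-algebra homomorphism $k[X,Y,Z]\to k[T]$, $X\mapsto T^a$, $Y\mapsto T^b$, $Z\mapsto T^c$. Then the following conditions are equivalent: 1. $H$ is pseudo-symmetric; 2. $H$ has a defining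 matrix, and its exponents satisfy $\beta\gamma=1$ or $\alpha'\beta'=1$; 3. $d=\frac{a+1}{2}$ or $d=\frac{c+1}{2}$. Moreover, the equivalence of 1 with "$\beta\gamma=1$ or $\alpha'\beta'=1$" holds for the exponents of every defining matrix of $H$. -/

import Mathlib

namespace NumericalSemigroup

/-- A submonoid of `ℕ` is a numerical semigroup if its complement in `ℕ` is finite. -/
def IsNumericalSemigroup (H : AddSubmonoid ℕ) : Prop :=
  ((H : Set ℕ)ᶜ).Finite

/-- The minimal generators of `H`: the nonzero elements of `H` that are not the sum of two nonzero
elements of `H`. They form the unique minimal system of generators of `H`. -/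
def minimalGenerators (H : AddSubmonoid ℕ) : Set ℕ :=
  {x | x ∈ H ∧ x ≠ 0 ∧ ∀ y ∈ H, ∀ z ∈ H, y ≠ 0 → z ≠ 0 → x ≠ y + z}

/-- The embedding dimension `e(H)`: the number of minimal generators. -/
noncomputable def embDim (H : AddSubmonoid ℕ) : ℕ :=
  (minimalGenerators H).ncard

/-- `H` regarded as a set of integers. -/
def toIntSet (H : AddSubmonoid ℕ) : Set ℤ :=
  (fun n : ℕ => (n : ℤ)) '' (H : Set ℕ)

/-- The Frobenius number `F(H)`: the largest integer that does not belong to `H`. -/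
noncomputable def frobenius (H : AddSubmonoid ℕ) : ℤ :=
  sSup (toIntSet H)ᶜ

/-- `H` is pseudo-symmetric: `F(H)` is even, and every integer `z ≠ F(H) / 2` satisfies `z ∈ H` or
`F(H) - z ∈ H`. (Evenness separates pseudo-symmetric from symmetric semigroups; the condition is
equivalent to `2 g(H) = F(H) + 2`, where `g(H)` is the number of gaps.) -/
def IsPseudoSymmetric (H : AddSubmonoid ℕ) : Prop :=
  Even (frobenius H) ∧
    ∀ z : ℤ, 2 * z ≠ frobenius H → z ∈ toIntSet H ∨ frobenius H - z ∈ toIntSet H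

/-- The solutions of the proportionally modular Diophantine inequality `p x mod q ≤ r x`.
(For positive `p, q, r`, no negative integer is a solution.) -/
def propModularSet (p q r : ℕ) : Set ℕ :=
  {x | (p * x) % q ≤ r * x}

/-- `H` is proportionally modular. -/
def IsProportionallyModular (H : AddSubmonoid ℕ) : Prop :=
  ∃ p q r : ℕ, 0 < p ∧ 0 < q ∧ 0 < r ∧ (H : Set ℕ) = propModularSet p q r

open MvPolynomial in
/-- The `k`-algebra homomorphism `k[X, Y, Z] → k[T]` with `X ↦ T ^ a`, `Y ↦ T ^ b`, `Z ↦ T ^ c`,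
whose image is the semigroup ring `k[⟨a, b, c⟩]`. -/
noncomputable def monomialCurveHom (k : Type*) [Field k] (a b c : ℕ) :
    MvPolynomial (Fin 3) k →ₐ[k] Polynomial k :=
  aeval ![Polynomial.X ^ a, Polynomial.X ^ b, Polynomial.X ^ c]

/-- The six exponents of a matrix of Herzog's shape. -/
structure HerzogExponents where
  α : ℕ
  β : ℕ
  γ : ℕ
  α' : ℕ
  β' : ℕ
  γ' : ℕ

open MvPolynomial in
/-- The matrix with rows `(X ^ α, Y ^ β, Z ^ γ)` and `(Y ^ β', Z ^ γ', X ^ α')`. -/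
noncomputable def HerzogExponents.matrix (k : Type*) [Field k] (E : HerzogExponents) :
    Matrix (Fin 2) (Fin 3) (MvPolynomial (Fin 3) k) :=
  !![X 0 ^ E.α, X 1 ^ E.β, X 2 ^ E.γ; X 1 ^ E.β', X 2 ^ E.γ', X 0 ^ E.α']

/-- The ideal generated by the maximal minors of a `2 × 3` matrix. -/
def maximalMinorsIdeal {R : Type*} [CommRing R] (M : Matrix (Fin 2) (Fin 3) R) : Ideal R :=
  Ideal.span (Set.range fun f : Fin 2 ↪o Fin 3 => (M.submatrix id f).det)

/-- `E` consists of positive exponents whose matrix is a defining matrix of `⟨a, b, c⟩`: its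
maximal minors generate the kernel of `k[X, Y, Z] → k[T]`. -/
def HerzogExponents.IsDefining (k : Type*) [Field k] (E : HerzogExponents) (a b c : ℕ) : Prop :=
  0 < E.α ∧ 0 < E.β ∧ 0 < E.γ ∧ 0 < E.α' ∧ 0 < E.β' ∧ 0 < E.γ' ∧
    RingHom.ker (monomialCurveHom k a b c) = maximalMinorsIdeal (E.matrix k)

end NumericalSemigroup

/-! Since c ≡ -a mod b, an integer ia + tb with 0 ≤ i < b lies in H exactly when t ≥ 0 or t ≥ c - id
(`mem_toIntSet_iff`). Up to swapping a and c, F(H) = ma - b with m = ⌊c/d⌋. The reflection z ↦ F(H)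
- z sends class i to class m - i mod b. Classes i ≤ m never obstruct; each of the b - 1 - m classes
i > m holds exactly c - md integers z with neither z nor F(H) - z in H. Pseudo-symmetry allows
exactly one such z, so b = m + 2 and c = md + 1, that is, a = 2d - 1
(`isPseudoSymmetric_iff_of_le`).

On the algebraic side, a defining matrix has α = γ' = 1, d = β + β', a = dγ + β' and c = dα' + β
(`formulas`). Hence βγ = 1 means a = 2d - 1, and α'β' = 1 means c = 2d - 1. Conversely, exponents
satisfying these formulas with b = α' + γ + 1 do define H (`isDefining_of_formulas`), by reduction
to normal forms that are separated by degree. -/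

namespace NumericalSemigroup

/-! ### Membership and Frobenius number when db = a + c -/

/-- The numerical data of a three-generated semigroup `⟨a, b, c⟩` with `d * b = a + c`. -/
structure BezoutTriple (a b c d : ℕ) : Prop where
  coprime : Nat.Coprime a b
  eq : d * b = a + c
  two_le : 2 ≤ d
  lt_left : d < a
  lt_right : d < c

theorem mem_closure_triple {a b c n : ℕ} :
    n ∈ AddSubmonoid.closure {a, b, c} ↔ ∃ x y z : ℕ, n = x * a + y * b + z * c := by
  rw [Set.insert_eq, AddSubmonoid.closure_union, AddSubmonoid.mem_sup]
  simp only [AddSubmonoid.mem_closure_singleton, AddSubmonoid.mem_closure_pair, smul_eq_mul]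
  constructor
  · rintro ⟨_, ⟨x, rfl⟩, _, ⟨y, z, rfl⟩, rfl⟩
    exact ⟨x, y, z, by ring⟩
  · rintro ⟨x, y, z, rfl⟩
    exact ⟨_, ⟨x, rfl⟩, _, ⟨y, z, rfl⟩, by ring⟩

theorem closure_triple_comm (a b c : ℕ) :
    AddSubmonoid.closure {a, b, c} = AddSubmonoid.closure {c, b, a} := by
  congr 1
  ext x
  simp only [Set.mem_insert_iff, Set.mem_singleton_iff]
  tauto

namespace BezoutTriple

variable {a b c d : ℕ}

theorem pos (h : BezoutTriple a b c d) : 0 < b := by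
  rcases Nat.eq_zero_or_pos b with rfl | hb
  · have := h.eq
    have := h.lt_left
    omega
  · exact hb

theorem symm (h : BezoutTriple a b c d) : BezoutTriple c b a d where
  coprime := by
    have hg : Nat.gcd c b ∣ a := by
      have : Nat.gcd c b ∣ a + c := h.eq ▸ (Nat.gcd_dvd_right c b).mul_left d
      exact (Nat.dvd_add_left (Nat.gcd_dvd_left c b)).1 this
    exact Nat.eq_one_of_dvd_coprimes h.coprime hg (Nat.gcd_dvd_right c b)
  eq := by rw [h.eq, add_comm]
  two_le := h.two_le
  lt_left := h.lt_right
  lt_right := h.lt_left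

theorem eq_int (h : BezoutTriple a b c d) : (d : ℤ) * b = a + c := by exact_mod_cast h.eq

/-- Every integer has the form `i * a + t * b` with `0 ≤ i < b`. -/
theorem exists_repr (h : BezoutTriple a b c d) (z : ℤ) :
    ∃ i t : ℤ, 0 ≤ i ∧ i < b ∧ z = i * a + t * b := by
  have hb : (0 : ℤ) < b := by exact_mod_cast h.pos
  have hco : (a : ℤ) * Nat.gcdA a b + b * Nat.gcdB a b = 1 := by
    rw [← Nat.gcd_eq_gcd_ab, h.coprime.gcd_eq_one, Nat.cast_one]
  refine ⟨(z * Nat.gcdA a b) % b, z * Nat.gcdB a b + (z * Nat.gcdA a b) / b * a,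
    Int.emod_nonneg _ hb.ne', Int.emod_lt_of_pos _ hb, ?_⟩
  have h2 := Int.emod_add_mul_ediv (z * Nat.gcdA a b) b
  linear_combination (-a : ℤ) * h2 - z * hco

theorem dvd_of_repr (h : BezoutTriple a b c d) {u v : ℤ} (huv : u * a = v * b) : (b : ℤ) ∣ u := by
  have hco : IsCoprime (b : ℤ) (a : ℤ) := Nat.isCoprime_iff_coprime.2 h.coprime.symm
  exact hco.dvd_of_dvd_mul_right (Dvd.intro_left v huv.symm)

/-- The least element of H congruent to ia mod b is the smaller of ia and (b - i)c = ia + (c - id)b.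
-/
theorem mem_toIntSet_iff (h : BezoutTriple a b c d) {i t : ℤ} (hi : 0 ≤ i) (hib : i < b) :
    i * a + t * b ∈ toIntSet (AddSubmonoid.closure {a, b, c}) ↔ 0 ≤ t ∨ (c : ℤ) ≤ t + i * d := by
  have hd := h.eq_int
  have hb : (0 : ℤ) < b := by exact_mod_cast h.pos
  constructor
  · rintro ⟨n, hn, hnz⟩
    obtain ⟨x, y, w, rfl⟩ := mem_closure_triple.1 hn
    push_cast at hnz
    -- Here xa + yb + wc = (x - w)a + (y + wd)b, so x - w = i + sb. The sign of s decides which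
    -- alternative holds.
    obtain ⟨s, hs⟩ := h.dvd_of_repr (u := x - w - i) (v := t - y - w * d)
      (by linear_combination hnz + (w : ℤ) * hd)
    have ht : t = y + w * d + s * a := by
      have : t * b = (y + w * d + s * a) * b := by
        linear_combination hs * a - hnz - (w : ℤ) * hd
      exact mul_right_cancel₀ hb.ne' this
    have hx : (0 : ℤ) ≤ x := Int.natCast_nonneg _
    have hy : (0 : ℤ) ≤ y := Int.natCast_nonneg _
    have hw : (0 : ℤ) ≤ w := Int.natCast_nonneg _
    have hd0 : (0 : ℤ) ≤ d := Int.natCast_nonneg _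
    have ha0 : (0 : ℤ) ≤ a := Int.natCast_nonneg _
    have hc0 : (0 : ℤ) ≤ c := Int.natCast_nonneg _
    rcases le_or_gt 0 s with h0 | h0
    · left
      rw [ht]
      positivity
    · right
      have hi' : i = x - w - b * s := by linear_combination -hs
      have h3 : t + i * d = y + x * d + (-s) * c := by
        rw [ht, hi']
        linear_combination (-s) * hd
      have : (c : ℤ) ≤ (-s) * c := by nlinarith
      have : 0 ≤ (x : ℤ) * d := by positivity
      linarith
  · rintro (ht | ht)
    · lift i to ℕ using hi
      lift t to ℕ using ht
      exact ⟨i * a + t * b, mem_closure_triple.2 ⟨i, t, 0, by ring⟩, by push_cast; ring⟩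
    · obtain ⟨y, hy⟩ := Int.eq_ofNat_of_zero_le (sub_nonneg.2 ht)
      obtain ⟨w, hw⟩ := Int.eq_ofNat_of_zero_le (sub_nonneg.2 hib.le)
      refine ⟨y * b + w * c, mem_closure_triple.2 ⟨0, y, w, by ring⟩, ?_⟩
      push_cast
      rw [← hy, ← hw]
      linear_combination i * hd

/-- The largest non-member in class i is ia - b for i ≤ m and (b - i)c - b for i > m; in the latter
case b - i ≤ n. -/
theorem frobenius_eq (h : BezoutTriple a b c d) {m n : ℤ} (hm : m * d ≤ c) (hm' : c < (m + 1) * d)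
    (hn' : a < (n + 1) * d) (hmn : n * c ≤ m * a) :
    IsGreatest (toIntSet (AddSubmonoid.closure {a, b, c}))ᶜ (m * a - b) := by
  have hd := h.eq_int
  have hb : (0 : ℤ) < b := by exact_mod_cast h.pos
  have hd0 : (0 : ℤ) < d := by exact_mod_cast lt_of_lt_of_le two_pos h.two_le
  have ha : (d : ℤ) < a := by exact_mod_cast h.lt_left
  have hc : (d : ℤ) < c := by exact_mod_cast h.lt_right
  have hm0 : 0 < m := by
    by_contra! h0
    nlinarith
  have hmb : m < b := by
    by_contra! h0
    nlinarith
  constructor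
  · have := (h.mem_toIntSet_iff (t := -1) hm0.le hmb).not.2 (by omega)
    rwa [neg_one_mul, ← sub_eq_add_neg] at this
  · intro z hz
    obtain ⟨i, t, hi, hib, rfl⟩ := h.exists_repr z
    have hz := (h.mem_toIntSet_iff hi hib).not.1 hz
    push Not at hz
    obtain ⟨ht, hti⟩ := hz
    have htb : t * b ≤ -b := by nlinarith
    rcases le_or_gt i m with him | him
    · nlinarith
    · have h1 : c < i * d := by nlinarith
      have h2 : b - i ≤ n := by
        have : (b - i) * d < (n + 1) * d := by nlinarith
        have := lt_of_mul_lt_mul_right this hd0.le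
        omega
      have h3 : (b - i) * (c : ℤ) ≤ n * c := by nlinarith
      have h4 : t * b ≤ (c - 1 - i * d) * b := by nlinarith
      have h5 : (c - 1 - i * d) * (b : ℤ) = c * b - b - i * (a + c) := by
        rw [← hd]; ring
      nlinarith

/-! ### Numerical criterion for pseudo-symmetry -/

theorem isPseudoSymmetric_iff_of_le (h : BezoutTriple a b c d) {m n : ℤ} (hm : m * d ≤ c)
    (hm' : c < (m + 1) * d) (hn' : a < (n + 1) * d) (hmn : n * c ≤ m * a) :
    IsPseudoSymmetric (AddSubmonoid.closure {a, b, c}) ↔ 2 * d = a + 1 ∨ 2 * d = c + 1 := by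
  have hF := h.frobenius_eq hm hm' hn' hmn
  have hFeq : frobenius (AddSubmonoid.closure {a, b, c}) = m * a - b := hF.csSup_eq
  have hd := h.eq_int
  have hb : (0 : ℤ) < b := by exact_mod_cast h.pos
  have hd2 : (2 : ℤ) ≤ d := by exact_mod_cast h.two_le
  have ha : (d : ℤ) < a := by exact_mod_cast h.lt_left
  have hc : (d : ℤ) < c := by exact_mod_cast h.lt_right
  have hm0 : 0 < m := by
    by_contra! h0
    nlinarith
  have hmb : m + 1 < b := by
    by_contra! h0
    nlinarith
  have hrefl : ∀ i t : ℤ, m < i → i < b → ((m * a - b - (i * a + t * b) ∈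
      toIntSet (AddSubmonoid.closure {a, b, c})) ↔ t < (m - i) * d) := by
    intro i t him hib
    -- The coefficient m - i is negative, so ba is moved across to bring it into [0, b).
    have : m * a - b - (i * a + t * b) = (m - i + b) * a + (-1 - t - a) * b := by ring
    rw [this, h.mem_toIntSet_iff (by omega) (by omega)]
    have h1 : (m - i + b) * (d : ℤ) = (m - i) * d + a + c := by linear_combination hd
    have h2 : (m - i) * (d : ℤ) ≤ -d := by nlinarith
    have h3 : -(a : ℤ) < (m - i) * d := by nlinarith
    rw [h1]
    omega
  have hlow : ∀ i t : ℤ, 0 ≤ i → i ≤ m → 0 ≤ t ∨ (m * a - b - (i * a + t * b) ∈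
      toIntSet (AddSubmonoid.closure {a, b, c})) := by
    intro i t hi him
    have : m * a - b - (i * a + t * b) = (m - i) * a + (-1 - t) * b := by ring
    rw [this, h.mem_toIntSet_iff (by omega) (by omega)]
    omega
  rw [IsPseudoSymmetric, hFeq]
  constructor
  · rintro ⟨⟨e, he⟩, hps⟩
    -- For t in this window neither z nor F(H) - z is in H, so z can only be F(H)/2.
    have hbad : ∀ i t : ℤ, m < i → i < b → (m - i) * d ≤ t → t < c - i * d →
        2 * (i * a + t * b) = m * a - b := by
      intro i t him hib h1 h2
      by_contra hne
      have h3 : (m - i) * (d : ℤ) ≤ -d := by nlinarith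
      have h4 : i * (d : ℤ) ≥ (m + 1) * d := by nlinarith
      rcases hps _ hne with h5 | h5
      · rw [h.mem_toIntSet_iff (by omega) hib] at h5
        omega
      · rw [hrefl i t him hib] at h5
        omega
    have hmul : (m - (m + 1)) * (d : ℤ) = -d := by ring
    have hmul' : (m + 1) * (d : ℤ) = m * d + d := by ring
    rcases hm.eq_or_lt with heq | hlt
    -- If c = md the windows are empty and H is symmetric. Then F(H)/2 would lie in H, and so would
    -- F(H).
    · exfalso
      obtain ⟨i, t, hi, hib, hz⟩ := h.exists_repr e
      have hself : m * a - b - (i * a + t * b) = i * a + t * b := by rw [he, hz]; ring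
      have hmem : i * a + t * b ∈ toIntSet (AddSubmonoid.closure {a, b, c}) := by
        rcases le_or_gt i m with him | him
        · rcases hlow i t hi him with h1 | h1
          · exact (h.mem_toIntSet_iff hi hib).2 (Or.inl h1)
          · rwa [hself] at h1
        · have h1 := hrefl i t him hib
          rw [hself] at h1
          rw [h1]
          by_contra h2
          refine h2 (h1.1 ((h.mem_toIntSet_iff hi hib).2 (Or.inr ?_)))
          nlinarith
      apply hF.1
      obtain ⟨x, hx, hxe⟩ := hmem
      refine ⟨x + x, add_mem hx hx, ?_⟩
      push_cast
      rw [he, hz, ← hxe]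
    -- The windows of classes m + 1 and b - 1 both contain only F(H)/2, so the classes coincide; a
    -- window longer than one would give a second value.
    · have h1 := hbad (m + 1) (-d) (by omega) hmb (by omega) (by omega)
      have h2 := hbad (b - 1) ((m - (b - 1)) * d) (by omega) (by omega) le_rfl (by nlinarith)
      left
      have hc1 : (c : ℤ) = m * d + 1 := by
        by_contra hne
        have h3 := hbad (m + 1) (-d + 1) (by omega) hmb (by omega) (by omega)
        nlinarith
      have hb2 : (b : ℤ) = m + 2 := by
        have h4 : ((b : ℤ) - 2 - m) * a = ((b : ℤ) - 2 - m) * d * b := by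
          linarith
        have h5 : ((b : ℤ) - 2 - m) * c = 0 := by
          linear_combination -h4 - ((b : ℤ) - 2 - m) * hd
        rcases mul_eq_zero.1 h5 with h6 | h6 <;> omega
      rw [hb2, hc1] at hd
      zify
      linear_combination hd
  · intro hor
    have key : 2 * d = a + 1 := by
      rcases hor with h1 | h1
      · exact h1
      -- With c = 2d - 1, the assumption nc ≤ ma leaves only d = 2 and a = b = 3, which is not
      -- coprime.
      · exfalso
        have hc1 : (c : ℤ) = 2 * d - 1 := by omega
        have ha1 : (a : ℤ) = d * (b - 2) + 1 := by linear_combination -hd - hc1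
        have hb3 : (3 : ℤ) ≤ b := by
          by_contra! h0
          have : (b : ℤ) - 2 ≤ 0 := by omega
          nlinarith
        have hm1 : m = 1 := by
          have : m < 2 := by
            by_contra! h0
            nlinarith
          omega
        have hn1 : (b : ℤ) - 2 ≤ n := by
          by_contra! h0
          nlinarith
        rw [hm1, hc1, ha1] at hmn
        have h2 : ((b : ℤ) - 2) * (2 * d - 1) ≤ n * (2 * d - 1) :=
          mul_le_mul_of_nonneg_right hn1 (by omega)
        have h3 : ((b : ℤ) - 2) * (d - 1) ≤ 1 := by nlinarith
        have h4 : (b : ℤ) = 3 := by nlinarith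
        have h5 : (d : ℤ) = 2 := by
          rw [h4] at h3
          omega
        rw [h4, h5] at ha1
        have hco := h.coprime
        have ha3 : a = 3 := by omega
        have hb3 : b = 3 := by omega
        rw [ha3, hb3] at hco
        norm_num at hco
    have ha1 : (a : ℤ) = 2 * d - 1 := by omega
    have hc1 : (c : ℤ) = d * (b - 2) + 1 := by linear_combination -hd - ha1
    have hm2 : m = b - 2 := by
      have : (b : ℤ) - 2 < m + 1 := by
        by_contra! h0
        nlinarith
      omega
    have hFe : m * a - b = 2 * ((b - 1) * a + (-d) * b) := by
      rw [hm2]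
      linear_combination (-b : ℤ) * ha1
    refine ⟨⟨(b - 1) * a + (-d) * b, by rw [hFe]; ring⟩, fun z hz => ?_⟩
    obtain ⟨i, t, hi, hib, rfl⟩ := h.exists_repr z
    rcases le_or_gt i m with him | him
    · rcases hlow i t hi him with h1 | h1
      · exact Or.inl ((h.mem_toIntSet_iff hi hib).2 (Or.inl h1))
      · exact Or.inr h1
    · have hi1 : i = b - 1 := by omega
      rw [hrefl i t him hib, h.mem_toIntSet_iff hi hib]
      have ht : t ≠ -d := by
        rintro rfl
        exact hz (by rw [hFe, hi1])
      have h1 : (m - i) * (d : ℤ) = -d := by rw [hm2, hi1]; ring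
      have h2 : i * (d : ℤ) = c + d - 1 := by rw [hi1, hc1]; ring
      rw [h1, h2]
      omega

theorem isPseudoSymmetric_iff (h : BezoutTriple a b c d) :
    IsPseudoSymmetric (AddSubmonoid.closure {a, b, c}) ↔ 2 * d = a + 1 ∨ 2 * d = c + 1 := by
  have hd0 : 0 < d := lt_of_lt_of_le two_pos h.two_le
  have hq (x : ℕ) : ((x / d : ℕ) : ℤ) * d ≤ x := by exact_mod_cast Nat.div_mul_le_self x d
  have hq' (x : ℕ) : (x : ℤ) < (((x / d : ℕ) : ℤ) + 1) * d := by
    exact_mod_cast Nat.lt_mul_of_div_lt (Nat.lt_succ_self _) hd0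
  rcases le_total (((a / d : ℕ) : ℤ) * c) (((c / d : ℕ) : ℤ) * a) with hle | hle
  · exact h.isPseudoSymmetric_iff_of_le (hq c) (hq' c) (hq' a) hle
  · rw [closure_triple_comm, or_comm]
    exact h.symm.isPseudoSymmetric_iff_of_le (hq a) (hq' a) (hq' c) hle

end BezoutTriple

/-! ### From minimal generation to the numerical data -/

/-- A minimal generator among `a, b, c` is not a combination of the other two. -/
theorem ne_of_mem_minimalGenerators {H : AddSubmonoid ℕ} {a b c : ℕ}
    (ha : a ∈ minimalGenerators H) (hb : b ∈ minimalGenerators H) (hc : c ∈ minimalGenerators H)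
    (hab : a ≠ b) (hac : a ≠ c) (u v : ℕ) : a ≠ u * b + v * c := by
  intro h
  obtain ⟨-, ha0, hmin⟩ := ha
  rcases u with _ | u
  · rcases v with _ | v
    · simp_all
    · refine hmin c hc.1 (v * c) (by simpa using H.nsmul_mem hc.1 v) hc.2.1 ?_ (by rw [h]; ring)
      intro hv
      exact hac (by rw [h, add_mul, hv]; ring)
  · refine hmin b hb.1 (u * b + v * c) (add_mem (by simpa using H.nsmul_mem hb.1 u)
      (by simpa using H.nsmul_mem hc.1 v)) hb.2.1 ?_ (by rw [h]; ring)
    intro hv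
    exact hab (by linarith)

theorem minimalGenerators_closure_subset (s : Set ℕ) :
    minimalGenerators (AddSubmonoid.closure s) ⊆ s := by
  rintro x ⟨hx, hx0, hmin⟩
  induction hx using AddSubmonoid.closure_induction with
  | mem x hx => exact hx
  | zero => exact absurd rfl hx0
  | add y z hy hz ihy ihz =>
    by_cases hy0 : y = 0
    · subst hy0
      rw [zero_add] at *
      exact ihz hx0 hmin
    · by_cases hz0 : z = 0
      · subst hz0
        rw [add_zero] at *
        exact ihy hx0 hmin
      · exact absurd rfl (hmin y hy z hz hy0 hz0)

theorem bezoutTriple_of_embDim {a b c d : ℕ}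
    (hnum : IsNumericalSemigroup (AddSubmonoid.closure {a, b, c}))
    (hdim : embDim (AddSubmonoid.closure {a, b, c}) = 3) (hd : d * b = a + c) :
    BezoutTriple a b c d := by
  have hsub := minimalGenerators_closure_subset {a, b, c}
  have hcard : Set.ncard {a, b, c} ≤ 3 := by
    refine (Set.ncard_insert_le _ _).trans (Nat.succ_le_succ ?_)
    exact (Set.ncard_insert_le _ _).trans (by simp)
  have heq : minimalGenerators (AddSubmonoid.closure {a, b, c}) = {a, b, c} :=
    Set.eq_of_subset_of_ncard_le hsub (by rw [embDim] at hdim; rw [hdim]; exact hcard)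
      (Set.toFinite _)
  have hcard3 : Set.ncard ({a, b, c} : Set ℕ) = 3 := by rw [← heq]; exact hdim
  have hpair (x y : ℕ) : Set.ncard ({x, y} : Set ℕ) ≤ 2 :=
    (Set.ncard_insert_le _ _).trans (by simp)
  have hab : a ≠ b := by
    rintro rfl
    have := hpair a c
    simp only [Set.insert_eq_of_mem, Set.mem_insert_iff, true_or] at hcard3
    omega
  have hac : a ≠ c := by
    rintro rfl
    have := hpair b a
    simp only [Set.insert_eq_of_mem, Set.mem_insert_iff, Set.mem_singleton_iff, or_true] at hcard3
    omega
  have hbc : b ≠ c := by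
    rintro rfl
    have := hpair a b
    simp only [Set.insert_eq_of_mem, Set.mem_singleton_iff] at hcard3
    omega
  have ha : a ∈ minimalGenerators (AddSubmonoid.closure {a, b, c}) := by simp [heq]
  have hb : b ∈ minimalGenerators (AddSubmonoid.closure {a, b, c}) := by simp [heq]
  have hc : c ∈ minimalGenerators (AddSubmonoid.closure {a, b, c}) := by simp [heq]
  have ha0 := ha.2.1
  have hb0 := hb.2.1
  refine ⟨?_, hd, ?_, ?_, ?_⟩
  · by_contra hg
    -- A common divisor g > 1 of a and b also divides c, so every gn + 1 is a gap.
    refine Set.Finite.not_infinite hnum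
      (Set.infinite_of_injective_forall_mem (f := fun n => Nat.gcd a b * n + 1) ?_ ?_)
    · intro x y hxy
      have : Nat.gcd a b * x = Nat.gcd a b * y := by simpa using hxy
      exact Nat.eq_of_mul_eq_mul_left (Nat.gcd_pos_of_pos_left _ (Nat.pos_of_ne_zero ha0)) this
    · intro n hn
      obtain ⟨x, y, z, hxyz⟩ := mem_closure_triple.1 hn
      have h1 : Nat.gcd a b ∣ c := by
        have : Nat.gcd a b ∣ a + c := hd ▸ (Nat.gcd_dvd_right a b).mul_left d
        exact (Nat.dvd_add_right (Nat.gcd_dvd_left a b)).1 this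
      have h2 : Nat.gcd a b ∣ Nat.gcd a b * n + 1 := by
        rw [hxyz]
        exact dvd_add (dvd_add ((Nat.gcd_dvd_left a b).mul_left x)
          ((Nat.gcd_dvd_right a b).mul_left y)) (h1.mul_left z)
      exact hg (Nat.dvd_one.1 ((Nat.dvd_add_right (Dvd.intro _ rfl)).1 h2))
  · by_contra! h2
    interval_cases d
    · omega
    · exact ne_of_mem_minimalGenerators hb ha hc hab.symm hbc 1 1 (by omega)
  · by_contra! h2
    obtain ⟨e, rfl⟩ := Nat.exists_eq_add_of_le h2
    obtain ⟨f, rfl⟩ := Nat.exists_eq_succ_of_ne_zero hb0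
    -- With d = a + e and b = f + 1, the relation db = a + c reads c = fa + eb.
    refine ne_of_mem_minimalGenerators hc ha hb hac.symm hbc.symm f e ?_
    rw [Nat.succ_eq_add_one] at *
    linarith
  · by_contra! h2
    obtain ⟨e, rfl⟩ := Nat.exists_eq_add_of_le h2
    obtain ⟨f, rfl⟩ := Nat.exists_eq_succ_of_ne_zero hb0
    refine ne_of_mem_minimalGenerators ha hc hb hac hab f e ?_
    rw [Nat.succ_eq_add_one] at *
    linarith


/-! ### Monomials and the ideal of minors -/

/-- The monomial `X ^ x * Y ^ y * Z ^ z`. -/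
noncomputable def mono (k : Type*) [Field k] (x y z : ℕ) : MvPolynomial (Fin 3) k :=
  MvPolynomial.X 0 ^ x * MvPolynomial.X 1 ^ y * MvPolynomial.X 2 ^ z

/-- The exponent vector `(x, y, z)`. -/
noncomputable def expo (x y z : ℕ) : Fin 3 →₀ ℕ :=
  Finsupp.equivFunOnFinite.symm ![x, y, z]

section Monomials

variable (k : Type*) [Field k]

theorem mono_eq_monomial (x y z : ℕ) : mono k x y z = MvPolynomial.monomial (expo x y z) 1 := by
  rw [mono, MvPolynomial.X_pow_eq_monomial, MvPolynomial.X_pow_eq_monomial,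
    MvPolynomial.X_pow_eq_monomial, MvPolynomial.monomial_mul, MvPolynomial.monomial_mul, one_mul,
    one_mul]
  refine congrArg (fun s => MvPolynomial.monomial s (1 : k)) (Finsupp.ext fun i => ?_)
  fin_cases i <;> simp [expo]

theorem monomial_one_eq_mono (s : Fin 3 →₀ ℕ) :
    MvPolynomial.monomial s 1 = mono k (s 0) (s 1) (s 2) := by
  rw [mono_eq_monomial]
  refine congrArg (fun s => MvPolynomial.monomial s (1 : k)) (Finsupp.ext fun i => ?_)
  fin_cases i <;> simp [expo]

theorem mono_mul_mono (x y z x' y' z' : ℕ) :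
    mono k x y z * mono k x' y' z' = mono k (x + x') (y + y') (z + z') := by
  simp only [mono, pow_add]
  ring

theorem expo_le_expo {x y z x' y' z' : ℕ} :
    expo x y z ≤ expo x' y' z' ↔ x ≤ x' ∧ y ≤ y' ∧ z ≤ z' := by
  rw [Finsupp.le_def]
  simp [Fin.forall_fin_succ, expo]

theorem monomialCurveHom_mono (a b c x y z : ℕ) :
    monomialCurveHom k a b c (mono k x y z) = Polynomial.X ^ (x * a + y * b + z * c) := by
  simp only [monomialCurveHom, mono, map_mul, map_pow, MvPolynomial.aeval_X]
  simp only [Matrix.cons_val_zero, Matrix.cons_val_one, Matrix.cons_val, ← pow_mul, ← pow_add]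
  ring_nf

theorem mono_sub_mem_ker_iff {a b c x y z x' y' z' : ℕ} :
    mono k x y z - mono k x' y' z' ∈ RingHom.ker (monomialCurveHom k a b c) ↔
      x * a + y * b + z * c = x' * a + y' * b + z' * c := by
  rw [RingHom.mem_ker, map_sub, monomialCurveHom_mono, monomialCurveHom_mono, sub_eq_zero]
  refine ⟨fun h => ?_, fun h => by rw [h]⟩
  simpa using congrArg Polynomial.natDegree h

theorem coeff_mul_mono_eq_zero (p : MvPolynomial (Fin 3) k) {e : Fin 3 →₀ ℕ} {x y z : ℕ}
    (h : ¬ expo x y z ≤ e) : MvPolynomial.coeff e (p * mono k x y z) = 0 := by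
  rw [mono_eq_monomial, MvPolynomial.coeff_mul_monomial', if_neg h]

theorem HerzogExponents.maximalMinorsIdeal_eq (E : HerzogExponents) :
    maximalMinorsIdeal (E.matrix k) = Ideal.span
      {mono k E.α 0 E.γ' - mono k 0 (E.β + E.β') 0,
        mono k (E.α + E.α') 0 0 - mono k 0 E.β' E.γ,
        mono k E.α' E.β 0 - mono k 0 0 (E.γ + E.γ')} := by
  rw [maximalMinorsIdeal]
  congr 1
  ext p
  simp only [Set.mem_range, Set.mem_insert_iff, Set.mem_singleton_iff, Matrix.det_fin_two,
    Matrix.submatrix_apply, id]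
  have e0 : (E.matrix k) 0 0 * (E.matrix k) 1 1 - (E.matrix k) 0 1 * (E.matrix k) 1 0 =
      mono k E.α 0 E.γ' - mono k 0 (E.β + E.β') 0 := by
    simp [HerzogExponents.matrix, mono, pow_add]
  have e1 : (E.matrix k) 0 0 * (E.matrix k) 1 2 - (E.matrix k) 0 2 * (E.matrix k) 1 0 =
      mono k (E.α + E.α') 0 0 - mono k 0 E.β' E.γ := by
    simp [HerzogExponents.matrix, mono, pow_add, mul_comm]
  have e2 : (E.matrix k) 0 1 * (E.matrix k) 1 2 - (E.matrix k) 0 2 * (E.matrix k) 1 1 =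
      mono k E.α' E.β 0 - mono k 0 0 (E.γ + E.γ') := by
    simp [HerzogExponents.matrix, mono, pow_add, mul_comm]
  constructor
  · rintro ⟨f, rfl⟩
    have hlt : f 0 < f 1 := f.strictMono (by decide)
    generalize f 0 = i at *
    generalize f 1 = j at *
    fin_cases i <;> fin_cases j <;> first | exact absurd hlt (by decide) | skip
    · exact Or.inl e0
    · exact Or.inr (Or.inl e1)
    · exact Or.inr (Or.inr e2)
  · rintro (rfl | rfl | rfl)
    · exact ⟨Fin.succAboveOrderEmb 2, e0⟩
    · exact ⟨Fin.succAboveOrderEmb 1, e1⟩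
    · exact ⟨Fin.succAboveOrderEmb 0, e2⟩

/-- The ideal is generated by three binomials, so every monomial occurring in one of its elements is
divisible by one of their six terms. -/
theorem HerzogExponents.coeff_eq_zero {E : HerzogExponents} {p : MvPolynomial (Fin 3) k}
    (hp : p ∈ maximalMinorsIdeal (E.matrix k)) {x y z : ℕ}
    (h1 : ¬ (E.α ≤ x ∧ E.γ' ≤ z)) (h2 : ¬ (E.β + E.β' ≤ y)) (h3 : ¬ (E.α + E.α' ≤ x))
    (h4 : ¬ (E.β' ≤ y ∧ E.γ ≤ z)) (h5 : ¬ (E.α' ≤ x ∧ E.β ≤ y)) (h6 : ¬ (E.γ + E.γ' ≤ z)) :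
    MvPolynomial.coeff (expo x y z) p = 0 := by
  rw [E.maximalMinorsIdeal_eq k, Ideal.mem_span_insert] at hp
  obtain ⟨u, q, hq, rfl⟩ := hp
  obtain ⟨v, w, rfl⟩ := Ideal.mem_span_pair.1 hq
  simp only [mul_sub, MvPolynomial.coeff_add, MvPolynomial.coeff_sub]
  rw [coeff_mul_mono_eq_zero, coeff_mul_mono_eq_zero, coeff_mul_mono_eq_zero,
    coeff_mul_mono_eq_zero, coeff_mul_mono_eq_zero, coeff_mul_mono_eq_zero]
  · simp
  all_goals
    rw [expo_le_expo]
    omega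

theorem coeff_mono (x y z x' y' z' : ℕ) : MvPolynomial.coeff (expo x y z) (mono k x' y' z') =
    if x' = x ∧ y' = y ∧ z' = z then 1 else 0 := by
  classical
  rw [mono_eq_monomial, MvPolynomial.coeff_monomial]
  congr 1
  simp only [le_antisymm_iff (α := Fin 3 →₀ ℕ), expo_le_expo, eq_iff_iff]
  omega

end Monomials

/-! ### Exponents of defining matrices -/

section Defining

variable {k : Type*} [Field k] {a b c d : ℕ}

theorem HerzogExponents.IsDefining.formulas {E : HerzogExponents} (hE : E.IsDefining k a b c)
    (h : BezoutTriple a b c d) :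
    d = E.β + E.β' ∧ a = d * E.γ + E.β' ∧ c = d * E.α' + E.β := by
  obtain ⟨hα, hβ, hγ, hα', hβ', hγ', hker⟩ := hE
  have hb := h.pos
  have hd2 := h.two_le
  have hd := h.eq
  have h0 : mono k 1 0 1 - mono k 0 d 0 ∈ maximalMinorsIdeal (E.matrix k) := by
    rw [← hker, mono_sub_mem_ker_iff]
    omega
  -- Of the six terms, only X^α Z^γ' can divide XZ.
  have h1 : E.α = 1 ∧ E.γ' = 1 := by
    by_contra hne
    have := HerzogExponents.coeff_eq_zero k h0 (x := 1) (y := 0) (z := 1) (by omega) (by omega)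
      (by omega) (by omega) (by omega) (by omega)
    simp [coeff_mono] at this
  have hI : ∀ p ∈ ({mono k E.α 0 E.γ' - mono k 0 (E.β + E.β') 0,
        mono k (E.α + E.α') 0 0 - mono k 0 E.β' E.γ,
        mono k E.α' E.β 0 - mono k 0 0 (E.γ + E.γ')} : Set (MvPolynomial (Fin 3) k)),
      p ∈ RingHom.ker (monomialCurveHom k a b c) := by
    rw [hker, E.maximalMinorsIdeal_eq k]
    exact fun p hp => Ideal.subset_span hp
  have r0 := (mono_sub_mem_ker_iff k).1
    (hI (mono k E.α 0 E.γ' - mono k 0 (E.β + E.β') 0) (by simp))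
  have r1 := (mono_sub_mem_ker_iff k).1
    (hI (mono k (E.α + E.α') 0 0 - mono k 0 E.β' E.γ) (by simp))
  rw [h1.1, h1.2] at r0
  rw [h1.1] at r1
  have hdβ : d = E.β + E.β' := by
    have : d * b = (E.β + E.β') * b := by linarith
    exact Nat.eq_of_mul_eq_mul_right hb this
  have hα'c : E.α' * d ≤ c := by
    by_contra! hlt
    have hm : c < (c / d + 1) * d := Nat.lt_mul_of_div_lt (Nat.lt_succ_self _) (by omega)
    have hm' : c / d < E.α' := Nat.div_lt_of_lt_mul (by linarith)
    have hmb : c / d < b := Nat.div_lt_of_lt_mul (by rw [hd]; have := h.lt_left; omega)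
    generalize c / d = m at *
    obtain ⟨y, hy⟩ := Nat.exists_eq_add_of_lt hm
    obtain ⟨z, hz⟩ := Nat.exists_eq_add_of_lt hmb
    -- With m = ⌊c/d⌋, (m + 1)a = ((m + 1)d - c)b + (b - m - 1)c. Only X^(1 + α') can divide X^(m +
    -- 1), which forces α' ≤ m.
    have h2 : mono k (m + 1) 0 0 - mono k 0 (y + 1) z ∈ maximalMinorsIdeal (E.matrix k) := by
      rw [← hker, mono_sub_mem_ker_iff]
      zify at hy hz hd ⊢
      linear_combination (b : ℤ) * hy - ((m : ℤ) + 1) * hd + (c : ℤ) * hz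
    have := HerzogExponents.coeff_eq_zero k h2 (x := m + 1) (y := 0) (z := 0) (by omega) (by omega)
      (by omega) (by omega) (by omega) (by omega)
    simp [coeff_mono] at this
  have hBa : (E.α' + E.γ + 1) * a = b * (d * E.γ + E.β') := by
    zify at r1 hd ⊢
    linear_combination r1 - (E.γ : ℤ) * hd
  obtain ⟨t, ht⟩ : b ∣ E.α' + E.γ + 1 := h.coprime.symm.dvd_of_dvd_mul_right ⟨_, hBa⟩
  have hA : t * a = d * E.γ + E.β' := by
    rw [ht, mul_assoc] at hBa
    exact Nat.eq_of_mul_eq_mul_left hb hBa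
  have hC : t * c = d * E.α' + E.β := by
    zify at ht hA hd hdβ ⊢
    linear_combination (-t : ℤ) * hd - hA - (d : ℤ) * ht + hdβ
  -- If t ≥ 2, then 2c ≤ dα' + β < c + d < 2c.
  have ht1 : t = 1 := by
    have hc := h.lt_right
    have ht0 : t ≠ 0 := by
      rintro rfl
      omega
    by_contra hne
    have : 2 * c ≤ t * c := Nat.mul_le_mul_right _ (by omega)
    nlinarith
  rw [ht1, one_mul] at hA hC
  exact ⟨hdβ, hA, hC⟩

/-- If the monomials of equal degree agree modulo `I`, then `I` contains the kernel. -/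
theorem ker_le_of_mono_sub_mem {I : Ideal (MvPolynomial (Fin 3) k)}
    (hI : ∀ x y z x' y' z' : ℕ, x * a + y * b + z * c = x' * a + y' * b + z' * c →
      mono k x y z - mono k x' y' z' ∈ I) :
    RingHom.ker (monomialCurveHom k a b c) ≤ I := by
  classical
  -- One monomial is chosen in each attained degree; the default 0 is irrelevant on the image. The
  -- linear extension ψ inverts the parametrization modulo I.
  let ρ : ℕ → MvPolynomial (Fin 3) k := fun n =>
    if hn : ∃ s : ℕ × ℕ × ℕ, s.1 * a + s.2.1 * b + s.2.2 * c = n then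
      mono k hn.choose.1 hn.choose.2.1 hn.choose.2.2 else 0
  have hρ (x y z : ℕ) : mono k x y z - ρ (x * a + y * b + z * c) ∈ I := by
    have hn : ∃ s : ℕ × ℕ × ℕ, s.1 * a + s.2.1 * b + s.2.2 * c = x * a + y * b + z * c :=
      ⟨(x, y, z), rfl⟩
    simp only [ρ, dif_pos hn]
    exact hI _ _ _ _ _ _ hn.choose_spec.symm
  let ψ : Polynomial k →ₗ[k] MvPolynomial (Fin 3) k := (Polynomial.basisMonomials k).constr k ρ
  have hψ (n : ℕ) : ψ (Polynomial.X ^ n) = ρ n := by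
    have := (Polynomial.basisMonomials k).constr_basis k ρ n
    simp only [Polynomial.coe_basisMonomials, Polynomial.monomial_one_right_eq_X_pow] at this
    exact this
  have key (f : MvPolynomial (Fin 3) k) : f - ψ (monomialCurveHom k a b c f) ∈ I := by
    induction f using MvPolynomial.induction_on' with
    | monomial s r =>
      have h1 : MvPolynomial.monomial s r = r • mono k (s 0) (s 1) (s 2) := by
        rw [← monomial_one_eq_mono, MvPolynomial.smul_monomial, smul_eq_mul, mul_one]
      rw [h1, map_smul, map_smul, monomialCurveHom_mono, hψ, ← smul_sub]
      exact Submodule.smul_of_tower_mem I r (hρ _ _ _)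
    | add f g hf hg =>
      rw [map_add, map_add, add_sub_add_comm]
      exact add_mem hf hg
  intro f hf
  have := key f
  rwa [(RingHom.mem_ker).1 hf, map_zero, sub_zero] at this

/-- Modulo b the degree is (x - z)a with -q ≤ x - z ≤ p. Since p + q < b and a is invertible, it
determines x - z, hence x and z, and then y. -/
theorem normalForm_unique {p q : ℕ} (hco : Nat.Coprime a b) (hd : d * b = a + c) (hb : p + q < b)
    {x y z x' y' z' : ℕ} (hn : z = 0 ∧ x ≤ p ∨ x = 0 ∧ z ≤ q)
    (hn' : z' = 0 ∧ x' ≤ p ∨ x' = 0 ∧ z' ≤ q)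
    (hdeg : x * a + y * b + z * c = x' * a + y' * b + z' * c) : x = x' ∧ y = y' ∧ z = z' := by
  have hb0 : 0 < b := by omega
  have hdvd {u v w : ℕ} (hu : u < b) (huv : u * a + v * b = w * b) : u = 0 := by
    have h1 : b ∣ u * a := (Nat.dvd_add_left (Dvd.intro_left v rfl)).1 (huv ▸ Dvd.intro_left w rfl)
    exact Nat.eq_zero_of_dvd_of_lt (hco.symm.dvd_of_dvd_mul_right h1) hu
  have hmixed {x y y' z : ℕ} (hx : x ≤ p) (hz : z ≤ q)
      (hxz : x * a + y * b = y' * b + z * c) : x = 0 ∧ z = 0 ∧ y = y' := by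
    have h1 : x + z = 0 := hdvd (v := y) (w := y' + z * d) (by omega) (by
      rw [add_mul _ _ b, mul_assoc, hd]
      linear_combination hxz)
    obtain ⟨rfl, rfl⟩ : x = 0 ∧ z = 0 := by omega
    exact ⟨rfl, rfl, Nat.eq_of_mul_eq_mul_right hb0 (by omega)⟩
  have hpure {x y x' y' : ℕ} (hx : x ≤ x') (hx' : x' ≤ p)
      (hxz : x * a + y * b = x' * a + y' * b) : x = x' ∧ y = y' := by
    obtain ⟨e, rfl⟩ := Nat.exists_eq_add_of_le hx
    obtain rfl : e = 0 := hdvd (v := y') (w := y) (by omega) (by linarith)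
    exact ⟨rfl, Nat.eq_of_mul_eq_mul_right hb0 (Nat.add_left_cancel hxz)⟩
  have hpure' {y z y' z' : ℕ} (hz : z ≤ z') (hz' : z' ≤ q)
      (hyz : y * b + z * c = y' * b + z' * c) : y = y' ∧ z = z' := by
    obtain ⟨e, rfl⟩ := Nat.exists_eq_add_of_le hz
    obtain rfl : e = 0 := hdvd (v := y) (w := y' + e * d) (by omega) (by
      rw [add_mul _ _ b, mul_assoc, hd]
      linarith)
    exact ⟨Nat.eq_of_mul_eq_mul_right hb0 (Nat.add_right_cancel hyz), rfl⟩
  rcases hn with ⟨rfl, hx⟩ | ⟨rfl, hz⟩ <;> rcases hn' with ⟨rfl, hx'⟩ | ⟨rfl, hz'⟩ <;>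
    simp only [zero_mul, zero_add, add_zero] at hdeg
  · rcases le_total x x' with hle | hle
    · have := hpure hle hx' hdeg
      exact ⟨this.1, this.2, rfl⟩
    · have := hpure hle hx hdeg.symm
      exact ⟨this.1.symm, this.2.symm, rfl⟩
  · obtain ⟨h1, h2, h3⟩ := hmixed hx hz' hdeg
    exact ⟨h1, h3, h2.symm⟩
  · obtain ⟨h1, h2, h3⟩ := hmixed hx' hz hdeg.symm
    exact ⟨h1.symm, h3.symm, h2⟩
  · rcases le_total z z' with hle | hle
    · exact ⟨rfl, hpure' hle hz' hdeg⟩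
    · have := hpure' hle hz hdeg.symm
      exact ⟨rfl, this.1.symm, this.2.symm⟩

theorem HerzogExponents.isDefining_of_formulas {E : HerzogExponents} (hco : Nat.Coprime a b)
    (hβ : 0 < E.β) (hγ : 0 < E.γ) (hα' : 0 < E.α') (hβ' : 0 < E.β') (hα : E.α = 1)
    (hγ' : E.γ' = 1) (ha : a = (E.β + E.β') * E.γ + E.β') (hb : b = E.α' + E.γ + 1)
    (hc : c = (E.β + E.β') * E.α' + E.β) : E.IsDefining k a b c := by
  refine ⟨by omega, hβ, hγ, hα', hβ', by omega, ?_⟩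
  have hd : (E.β + E.β') * b = a + c := by rw [ha, hb, hc]; ring
  have hr1 : (1 + E.α') * a = E.β' * b + E.γ * c := by rw [ha, hb, hc]; ring
  have hr2 : E.α' * a + E.β * b = (E.γ + 1) * c := by rw [ha, hb, hc]; ring
  rw [E.maximalMinorsIdeal_eq k, hα, hγ']
  set I : Ideal (MvPolynomial (Fin 3) k) := Ideal.span _ with hIdef
  have g0 : mono k 1 0 1 - mono k 0 (E.β + E.β') 0 ∈ I := Ideal.subset_span (by simp)
  have g1 : mono k (1 + E.α') 0 0 - mono k 0 E.β' E.γ ∈ I := Ideal.subset_span (by simp)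
  have g2 : mono k E.α' E.β 0 - mono k 0 0 (E.γ + 1) ∈ I := Ideal.subset_span (by simp)
  have hle : I ≤ RingHom.ker (monomialCurveHom k a b c) := by
    rw [hIdef, Ideal.span_le]
    rintro p (rfl | rfl | rfl) <;> refine (mono_sub_mem_ker_iff k).2 ?_ <;> linarith
  refine le_antisymm ?_ hle
  have ha0 : 0 < a := by rw [ha]; positivity
  have hb0 : 0 < b := by omega
  have hc0 : 0 < c := by rw [hc]; positivity
  -- Rewriting by XZ → Y^d, X^(1 + α') → Y^β' Z^γ and Z^(γ + 1) → X^α' Y^β preserves degree and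
  -- raises the Y-exponent, so xa + zc drops.
  have hnf : ∀ N x y z : ℕ, x * a + z * c ≤ N → ∃ x' y' z' : ℕ,
      (z' = 0 ∧ x' ≤ E.α' ∨ x' = 0 ∧ z' ≤ E.γ) ∧ mono k x y z - mono k x' y' z' ∈ I := by
    intro N
    induction N using Nat.strong_induction_on with
    | _ N ih =>
      intro x y z hN
      have step (u v w u' v' w' p q r : ℕ) (hg : mono k u v w - mono k u' v' w' ∈ I)
          (hx : x = p + u) (hy : y = q + v) (hz : z = r + w)
          (hlt : (p + u') * a + (r + w') * c < N) : ∃ x' y' z' : ℕ,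
          (z' = 0 ∧ x' ≤ E.α' ∨ x' = 0 ∧ z' ≤ E.γ) ∧ mono k x y z - mono k x' y' z' ∈ I := by
        obtain ⟨x', y', z', h1, h2⟩ := ih _ hlt (p + u') (q + v') (r + w') le_rfl
        refine ⟨x', y', z', h1, ?_⟩
        have h3 := add_mem (I.mul_mem_left (mono k p q r) hg) h2
        rw [mul_sub, mono_mul_mono, mono_mul_mono, sub_add_sub_cancel] at h3
        rwa [hx, hy, hz]
      have g2' : mono k 0 0 (E.γ + 1) - mono k E.α' E.β 0 ∈ I := by
        rw [← neg_sub]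
        exact neg_mem g2
      by_cases hxz : 1 ≤ x ∧ 1 ≤ z
      · obtain ⟨p, rfl⟩ := Nat.exists_eq_add_of_le' hxz.1
        obtain ⟨r, rfl⟩ := Nat.exists_eq_add_of_le' hxz.2
        exact step _ _ _ _ _ _ p y r g0 rfl rfl rfl (by nlinarith)
      by_cases hx : 1 + E.α' ≤ x
      · obtain ⟨p, rfl⟩ := Nat.exists_eq_add_of_le' hx
        refine step _ _ _ _ _ _ p y z g1 rfl rfl rfl ?_
        have : 0 < E.β' * b := by positivity
        nlinarith
      by_cases hz : E.γ + 1 ≤ z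
      · obtain ⟨r, rfl⟩ := Nat.exists_eq_add_of_le' hz
        refine step _ _ _ _ _ _ x y r g2' rfl rfl rfl ?_
        have : 0 < E.β * b := by positivity
        nlinarith
      exact ⟨x, y, z, by omega, by simp⟩
  refine ker_le_of_mono_sub_mem fun x y z x' y' z' hdeg => ?_
  obtain ⟨x₁, y₁, z₁, hn, hm⟩ := hnf _ x y z le_rfl
  obtain ⟨x₂, y₂, z₂, hn', hm'⟩ := hnf _ x' y' z' le_rfl
  have e₁ := (mono_sub_mem_ker_iff k).1 (hle hm)
  have e₂ := (mono_sub_mem_ker_iff k).1 (hle hm')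
  have hdeg' : x₁ * a + y₁ * b + z₁ * c = x₂ * a + y₂ * b + z₂ * c := by linarith
  have heq : x₁ = x₂ ∧ y₁ = y₂ ∧ z₁ = z₂ :=
    normalForm_unique hco hd (by omega) hn hn' hdeg'
  obtain ⟨rfl, rfl, rfl⟩ := heq
  have := sub_mem hm hm'
  rwa [sub_sub_sub_cancel_right] at this

theorem HerzogExponents.IsDefining.mul_eq_one_iff {E : HerzogExponents}
    (hE : E.IsDefining k a b c) (h : BezoutTriple a b c d) :
    (E.β * E.γ = 1 ∨ E.α' * E.β' = 1) ↔ 2 * d = a + 1 ∨ 2 * d = c + 1 := by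
  obtain ⟨hd, ha, hc⟩ := hE.formulas h
  obtain ⟨-, hβ, hγ, hα', hβ', -, -⟩ := hE
  -- Both cases have this shape: γ, α' are quotients by d, and the remainders β', β sum to d.
  have aux {x y z : ℕ} (hx : 0 < x) (hy : 0 < y) (hz : 0 < z) (hdxy : d = x + y) :
      x * z = 1 ↔ 2 * d = d * z + y + 1 := by
    rw [mul_eq_one]
    constructor
    · rintro ⟨rfl, rfl⟩
      omega
    · intro h1
      have hz1 : z = 1 := by
        by_contra hne
        have : d * 2 ≤ d * z := Nat.mul_le_mul_left _ (by omega)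
        omega
      subst hz1
      omega
  rw [aux hβ hβ' hγ hd, mul_comm E.α', aux hβ' hβ hα' (by omega), ha, hc]

theorem BezoutTriple.exists_isDefining (k : Type*) [Field k] (h : BezoutTriple a b c d)
    (hd : 2 * d = a + 1 ∨ 2 * d = c + 1) : ∃ E : HerzogExponents, E.IsDefining k a b c := by
  have hdb := h.eq
  have hd2 := h.two_le
  have hlt := h.lt_left
  have hlt' := h.lt_right
  have hb3 : 3 ≤ b := by
    by_contra! hb
    have : d * b ≤ d * 2 := Nat.mul_le_mul_left _ (by omega)
    omega
  obtain ⟨e, rfl⟩ := Nat.exists_eq_add_of_le hd2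
  obtain ⟨n, rfl⟩ := Nat.exists_eq_add_of_le hb3
  rcases hd with hd | hd
  · obtain rfl : a = 2 * e + 3 := by omega
    -- Division by d = e + 2 gives a = d·1 + (e + 1) and c = d(n + 1) + 1; the other case exchanges
    -- a and c.
    refine ⟨⟨1, 1, 1, n + 1, e + 1, 1⟩, HerzogExponents.isDefining_of_formulas h.coprime
      one_pos one_pos n.succ_pos e.succ_pos rfl rfl ?_ ?_ ?_⟩ <;> dsimp only <;> linarith
  · obtain rfl : c = 2 * e + 3 := by omega
    refine ⟨⟨1, e + 1, n + 1, 1, 1, 1⟩, HerzogExponents.isDefining_of_formulas h.coprime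
      e.succ_pos n.succ_pos one_pos one_pos rfl rfl ?_ ?_ ?_⟩ <;> dsimp only <;> linarith

end Defining
end NumericalSemigroup

theorem mainTheorem10 {k : Type*} [Field k] (H : AddSubmonoid ℕ) (a b c d : ℕ)
    (hnum : NumericalSemigroup.IsNumericalSemigroup H)
    (hgen : H = AddSubmonoid.closure {a, b, c})
    (hdim : NumericalSemigroup.embDim H = 3)
    (hpm : NumericalSemigroup.IsProportionallyModular H)
    (hd : d * b = a + c) :
    List.TFAE
      [NumericalSemigroup.IsPseudoSymmetric H,
        ∃ E : NumericalSemigroup.HerzogExponents,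
          E.IsDefining k a b c ∧ (E.β * E.γ = 1 ∨ E.α' * E.β' = 1),
        (d : ℚ) = ((a : ℚ) + 1) / 2 ∨ (d : ℚ) = ((c : ℚ) + 1) / 2] ∧
    ∀ E : NumericalSemigroup.HerzogExponents, E.IsDefining k a b c →
      (NumericalSemigroup.IsPseudoSymmetric H ↔ (E.β * E.γ = 1 ∨ E.α' * E.β' = 1)) := by
  subst hgen
  have h := NumericalSemigroup.bezoutTriple_of_embDim hnum hdim hd
  have hhalf (x : ℕ) : (d : ℚ) = ((x : ℚ) + 1) / 2 ↔ 2 * d = x + 1 := by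
    rw [eq_div_iff two_ne_zero, mul_comm]
    exact_mod_cast Iff.rfl
  rw [hhalf, hhalf]
  refine ⟨?_, fun E hE => h.isPseudoSymmetric_iff.trans (hE.mul_eq_one_iff h).symm⟩
  tfae_have 1 ↔ 3 := h.isPseudoSymmetric_iff
  tfae_have 3 → 2 := fun h3 => by
    obtain ⟨E, hE⟩ := h.exists_isDefining k h3
    exact ⟨E, hE, (hE.mul_eq_one_iff h).2 h3⟩
  tfae_have 2 → 3 := fun ⟨E, hE, h2⟩ => (hE.mul_eq_one_iff h).1 h2
  tfae_finish
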